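/- Let $\sigma>0$ and let $X=(X_t)_{t\ge 0}$, with laws $(P^x)_{x\in[0,1]}$, be one-dimensional reflected Brownian motion on $[0,1]$ with diffusion coefficient $\sigma$: under $P^x$ the process $X$ has almost surely continuous paths and the law of $\rho(x+\sigma W_t)$, $t\ge 0$, where $W$ is a standard Brownian motion on $\mathbb R$ and $\rho(y)$ is the distance from $y\in\mathbb R$ to the nearest even integer (reflection at $0$ and $1$; $\sigma=1$ is the standard normalisation, and the generator is $\tfrac{\sigma^2}{2}\tfrac{d^2}{dx^2}$ with Neumann boundary conditions). Let $B_1,B_2,\dots$ be finite subsets of $[0,1]$, and let $\mathcal C$ be the collection consisting of the empty set and all finite unions of sets drawn from $B_1,B_2,\dots$. For $C\in\mathcal C$ put $T_C=\inf\{t\ge 0: X_t\in C\}$ (with $\inf\emptyset=\infty$). Then $X$ satisfies the Barlow–Evans assumption: for every $C\in\mathcal C$, the resolvent of $X$ stopped on hitting $C$ maps $C([0,1])$ into itself, i.e. for every $\alpha>0$ and every continuous $f:[0,1]\to\mathbb R$ the function $$x\mapsto E^x\left[\int_0^\infty e^{-\alpha t} f(X_{t\wedge T_C})\,dt\right]$$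 is well defined and continuous on $[0,1]$. The same holds for the resolvent of $X$ killed on hitting $C$: for all such $C$, $\alpha$ and $f$, the function $$x\mapsto E^x\left[\int_0^{T_C} e^{-\alpha t} f(X_t)\,dt\right]$$ is well defined and continuous on $[0,1]$. -/

import Mathlib

open MeasureTheory ProbabilityTheory Set
open scoped NNReal

noncomputable section

namespace ReflectedBM

/-- The distance from `y` to the nearest even integer lies in `[0,1]`. -/
theorem fold_mem (y : ℝ) : |y - 2 * (round (y / 2) : ℝ)| ∈ unitInterval := by
  refine ⟨abs_nonneg _, ?_⟩
  have h := abs_sub_round (y / 2)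
  rw [abs_le] at h ⊢
  constructor <;> linarith [h.1, h.2]

/-- The folding map `ℝ → [0,1]`: the `2`-periodic triangle wave with `fold (2k) = 0` and
`fold (2k+1) = 1` that is linear between consecutive integers, that is, the distance to the nearest
even integer. It identifies `[0,1]` with the quotient of `ℝ` by the group generated by the
reflections in the points `0` and `1`. -/
def fold (y : ℝ) : unitInterval := ⟨|y - 2 * (round (y / 2) : ℝ)|, fold_mem y⟩

/-- `(X, P)` is reflected Brownian motion on `[0,1]` with diffusion coefficient `σ` (generator
`(σ²/2) d²/dx²` with Neumann boundary conditions; `σ = 1` is the standard normalisation):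
`P x` is the law under which `X` starts from `x`; under each `P x`, almost all paths of `X` are
continuous, and the law of `X` on path space is that of the doubly reflected Brownian motion
`fold (x + σ B)`, where `B` is a standard Brownian motion on the line. -/
structure IsReflectedBrownianMotion {Ω : Type*} [MeasurableSpace Ω] (σ : ℝ)
    (X : ℝ≥0 → Ω → unitInterval) (P : unitInterval → Measure Ω) : Prop where
  continuous_paths : ∀ x : unitInterval, ∀ᵐ ω ∂(P x), Continuous fun t ↦ X t ω
  law : ∀ x : unitInterval, ∃ (Ω' : Type) (_ : MeasurableSpace Ω') (Q : Measure Ω') (B : ℝ≥0 → Ω' → ℝ),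
    IsBrownianReal B Q ∧
    IdentDistrib (fun ω t ↦ X t ω) (fun ω' t ↦ fold ((x : ℝ) + σ * B t ω')) (P x) Q

end ReflectedBM

namespace BarlowEvans

variable {Ω F : Type*}

/-- First hitting time `T_C = inf {t ≥ 0 : X_t ∈ C}`, equal to `⊤` if `C` is never hit. -/
def hitTime (X : ℝ≥0 → Ω → F) (C : Set F) : Ω → WithTop ℝ≥0 := hittingAfter X C 0

/-- `(ω, t) ↦ e^{-αt} f(X_{t ∧ T_C}(ω))`, for the process stopped on hitting `C`. -/
def stoppedIntegrand (X : ℝ≥0 → Ω → F) (C : Set F) (α : ℝ) (f : F → ℝ) (p : Ω × ℝ) : ℝ :=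
  Real.exp (-α * p.2) * f (stoppedProcess X (hitTime X C) p.2.toNNReal p.1)

/-- `(ω, t) ↦ e^{-αt} f(X_t(ω)) 1_{t < T_C(ω)}`, for the process killed on hitting `C`
(functions vanish at the cemetery). -/
def killedIntegrand (X : ℝ≥0 → Ω → F) (C : Set F) (α : ℝ) (f : F → ℝ) : Ω × ℝ → ℝ :=
  {p | (p.2.toNNReal : WithTop ℝ≥0) < hitTime X C p.1}.indicator
    fun p ↦ Real.exp (-α * p.2) * f (X p.2.toNNReal p.1)

variable [MeasurableSpace Ω]

/-- Resolvent of the process stopped on hitting `C`: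
`U_α f(x) = E^x [∫₀^∞ e^{-αt} f(X_{t ∧ T_C}) dt]`. -/
def stoppedResolvent (X : ℝ≥0 → Ω → F) (P : F → Measure Ω) (C : Set F) (α : ℝ) (f : F → ℝ)
    (x : F) : ℝ :=
  ∫ ω, (∫ t in Ioi (0 : ℝ), stoppedIntegrand X C α f (ω, t)) ∂(P x)

/-- Resolvent of the process killed on hitting `C`:
`U_α f(x) = E^x [∫₀^{T_C} e^{-αt} f(X_t) dt]`. -/
def killedResolvent (X : ℝ≥0 → Ω → F) (P : F → Measure Ω) (C : Set F) (α : ℝ) (f : F → ℝ)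
    (x : F) : ℝ :=
  ∫ ω, (∫ t in Ioi (0 : ℝ), killedIntegrand X C α f (ω, t)) ∂(P x)

variable [TopologicalSpace F]

/-- For every `α > 0`, the resolvent of the process stopped on hitting `C` is well defined on `C(F)`
(the defining integrals converge absolutely) and maps `C(F)` into itself. -/
def StoppedResolventPreserves (X : ℝ≥0 → Ω → F) (P : F → Measure Ω) (C : Set F) : Prop :=
  ∀ α : ℝ, 0 < α → ∀ f : C(F, ℝ),
    (∀ x, Integrable (stoppedIntegrand X C α f) ((P x).prod (volume.restrict (Ioi (0 : ℝ))))) ∧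
    Continuous (stoppedResolvent X P C α f)

/-- For every `α > 0`, the resolvent of the process killed on hitting `C` is well defined on `C(F)`
(the defining integrals converge absolutely) and maps `C(F)` into itself. -/
def KilledResolventPreserves (X : ℝ≥0 → Ω → F) (P : F → Measure Ω) (C : Set F) : Prop :=
  ∀ α : ℝ, 0 < α → ∀ f : C(F, ℝ),
    (∀ x, Integrable (killedIntegrand X C α f) ((P x).prod (volume.restrict (Ioi (0 : ℝ))))) ∧
    Continuous (killedResolvent X P C α f)

/-- The collection consisting of the empty set and the finite unions of sets drawn from the
sequence `B`. -/
def finiteUnions (B : ℕ → Set F) : Set (Set F) := {C | ∃ s : Finset ℕ, C = ⋃ n ∈ s, B n}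

/-- The Barlow–Evans assumption for the process `(X, P)` on `F` and the sets `B₀, B₁, …`: for each
`C` in the collection, the resolvent of the process stopped on hitting `C` maps `C(F)` into
itself. -/
def Assumption (X : ℝ≥0 → Ω → F) (P : F → Measure Ω) (B : ℕ → Set F) : Prop :=
  ∀ C ∈ finiteUnions B, StoppedResolventPreserves X P C

end BarlowEvans

end

/-! All laws `P x` are realised at once by folding `x + σ W` for a single Brownian motion `W`, so
that continuity in `x` becomes an almost sure statement about coupled paths. For fixed `x`, it is
enough that the hitting time of `C` is almost surely continuous at `x`; dominated convergence in
`t`, then in `ω`, does the rest. The stopped integrand then converges for every `t`, the killed one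
for every `t` other than the hitting time.

Lower semicontinuity (`eventually_lt_hitTime`) is compactness: a path avoiding the closed set `C` on
`[0, s]` keeps avoiding it under small shifts. Upper semicontinuity
(`eventually_exists_coordinate_mem`) needs the path to pass through `C` rather than merely touch it.
Before folding, `C` becomes a countable set of levels `d`. If `x + σ W` goes strictly beyond `d`, on
the side away from `x`, just after reaching it, then nearby starting points also cross `d`, by the
intermediate value theorem.

Brownian motion does so almost surely at each fixed level (`ae_crossesUp`). At a positive level, a
failure would make the maximum over some interval with endpoints in a countable dense set equal to
that level, yet this maximum has no atoms. At level `0`, the running maximum is immediately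
positive. Negative levels follow by replacing `W` with `-W`. -/

noncomputable section

namespace BarlowEvans

/-! ### Hitting times along a path -/

section HitTime

variable {Ω F : Type*} {X : ℝ≥0 → Ω → F} {C : Set F} {ω : Ω} {t : ℝ≥0}

theorem hitTime_lt_iff : hitTime X C ω < t ↔ ∃ r < t, X r ω ∈ C := by
  rw [hitTime, hittingAfter_lt_iff]
  simp

theorem lt_hitTime_iff [TopologicalSpace F] (hC : IsClosed C)
    (hω : Continuous fun t ↦ X t ω) :
    (t : WithTop ℝ≥0) < hitTime X C ω ↔ ∀ r ≤ t, X r ω ∉ C := by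
  refine ⟨fun h r hr ↦ notMem_of_lt_hittingAfter ((WithTop.coe_le_coe.2 hr).trans_lt h) zero_le,
    fun h ↦ ?_⟩
  rw [hitTime, hittingAfter_def]
  dsimp only
  split_ifs with hex
  · have hmem : sInf {i : ℝ≥0 | 0 ≤ i ∧ X i ω ∈ C} ∈ {i : ℝ≥0 | 0 ≤ i ∧ X i ω ∈ C} := by
      refine IsClosed.csInf_mem ?_ hex (OrderBot.bddBelow _)
      simpa using! hC.preimage hω
    refine WithTop.coe_lt_coe.2 (not_le.1 fun hle ↦ h _ hle hmem.2)
  · exact WithTop.coe_lt_top t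

/-- The time `t ∧ T_C`. -/
def stopTime (X : ℝ≥0 → Ω → F) (C : Set F) (t : ℝ≥0) (ω : Ω) : ℝ≥0 :=
  (min (t : WithTop ℝ≥0) (hitTime X C ω)).untopA

theorem coe_stopTime : (stopTime X C t ω : WithTop ℝ≥0) = min (t : WithTop ℝ≥0) (hitTime X C ω) := by
  rw [stopTime, WithTop.untopA_eq_untop (ne_top_of_le_ne_top WithTop.coe_ne_top (min_le_left _ _)),
    WithTop.coe_untop]

theorem lt_stopTime_iff {s : ℝ≥0} :
    s < stopTime X C t ω ↔ s < t ∧ (s : WithTop ℝ≥0) < hitTime X C ω := by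
  rw [← WithTop.coe_lt_coe, coe_stopTime, lt_min_iff, WithTop.coe_lt_coe]

theorem stopTime_lt_iff {s : ℝ≥0} :
    stopTime X C t ω < s ↔ t < s ∨ hitTime X C ω < (s : WithTop ℝ≥0) := by
  rw [← WithTop.coe_lt_coe, coe_stopTime, min_lt_iff, WithTop.coe_lt_coe]

theorem stoppedProcess_hitTime :
    stoppedProcess X (hitTime X C) t ω = X (stopTime X C t ω) ω := rfl

theorem hitTime_congr {Ω' : Type*} {Y : ℝ≥0 → Ω' → F} {ω' : Ω'}
    (h : ∀ t, X t ω = Y t ω') : hitTime X C ω = hitTime Y C ω' := by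
  have : (fun t ↦ X t ω) = fun t ↦ Y t ω' := funext h
  exact congrArg (fun w ↦ hitTime (fun t (_ : Unit) ↦ w t) C ()) this

theorem stoppedIntegrand_congr {Ω' : Type*} {Y : ℝ≥0 → Ω' → F} {ω' : Ω'}
    (h : ∀ t, X t ω = Y t ω') (α : ℝ) (f : F → ℝ) (t : ℝ) :
    stoppedIntegrand X C α f (ω, t) = stoppedIntegrand Y C α f (ω', t) := by
  simp only [stoppedIntegrand, stoppedProcess_hitTime, stopTime, hitTime_congr h, h]

theorem killedIntegrand_congr {Ω' : Type*} {Y : ℝ≥0 → Ω' → F} {ω' : Ω'}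
    (h : ∀ t, X t ω = Y t ω') (α : ℝ) (f : F → ℝ) (t : ℝ) :
    killedIntegrand X C α f (ω, t) = killedIntegrand Y C α f (ω', t) := by
  simp only [killedIntegrand, indicator, mem_ofPred_eq, hitTime_congr h, h]

end HitTime

/-! ### Path space and joint measurability of the integrands -/

section PathSpace

variable (F : Type*) [TopologicalSpace F]

/-- The space of continuous paths in `F`, with the `σ`-algebra generated by the coordinates. -/
abbrev PathSpace : Type _ := {w : ℝ≥0 → F // Continuous w}

variable {F}

/-- The coordinate process on path space. -/
def coordinate (t : ℝ≥0) (w : PathSpace F) : F := w.1 t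

theorem continuous_coordinate (w : PathSpace F) : Continuous fun t ↦ coordinate t w := w.2

end PathSpace

section Measurability

variable {F : Type*} [MetricSpace F] {C : Set F}

/-- On the compact interval `[0, t]` the distance to the closed set `C` attains its minimum, so
avoiding `C` means staying at a uniform positive distance, which can be tested on a dense sequence
of times. This makes the event measurable for the coordinate `σ`-algebra. The extended distance also
covers empty `C`. -/
theorem forall_le_notMem_iff (hC : IsClosed C) {w : ℝ≥0 → F} (hw : Continuous w) (t : ℝ≥0) :
    (∀ r ≤ t, w r ∉ C) ↔
      ∃ n : ℕ, ∀ k : ℕ, (n : ENNReal)⁻¹ ≤ Metric.infEDist (w (min t (TopologicalSpace.denseSeq ℝ≥0 k))) C := by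
  have hc : Continuous fun r ↦ Metric.infEDist (w r) C := Metric.continuous_infEDist.comp hw
  constructor
  · intro h
    obtain ⟨r, hr, hmin⟩ := (isCompact_Icc (a := (0 : ℝ≥0)) (b := t)).exists_isMinOn
      ⟨0, by simp⟩ hc.continuousOn
    have hpos : Metric.infEDist (w r) C ≠ 0 := fun h0 ↦
      h r hr.2 (hC.closure_eq ▸ Metric.mem_closure_iff_infEDist_zero.2 h0)
    obtain ⟨n, hn⟩ := ENNReal.exists_inv_nat_lt hpos
    exact ⟨n, fun k ↦ hn.le.trans (hmin ⟨zero_le, min_le_left _ _⟩)⟩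
  · rintro ⟨n, hn⟩ r hr hmem
    have hclosed : IsClosed {s | (n : ENNReal)⁻¹ ≤ Metric.infEDist (w (min t s)) C} :=
      isClosed_le continuous_const (hc.comp (continuous_const.min continuous_id))
    have hall : {s | (n : ENNReal)⁻¹ ≤ Metric.infEDist (w (min t s)) C} = univ := by
      refine hclosed.closure_eq ▸ (Dense.mono ?_ (TopologicalSpace.denseRange_denseSeq ℝ≥0)).closure_eq
      rintro _ ⟨k, rfl⟩
      exact hn k
    have := hall.symm ▸ mem_univ r
    rw [mem_ofPred_eq, min_eq_right hr, Metric.infEDist_zero_of_mem hmem] at this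
    simp at this

theorem measurable_coordinate [MeasurableSpace F] (t : ℝ≥0) : Measurable (coordinate t : PathSpace F → F) :=
  (measurable_pi_apply t).comp measurable_subtype_coe

variable [MeasurableSpace F] [BorelSpace F]

theorem measurable_uncurry_coordinate :
    Measurable fun p : PathSpace F × ℝ≥0 ↦ coordinate p.2 p.1 :=
  (measurable_uncurry_of_continuous_of_measurable continuous_coordinate
    measurable_coordinate).comp measurable_swap

theorem measurableSet_lt_hitTime (hC : IsClosed C) :
    MeasurableSet {p : PathSpace F × ℝ≥0 | (p.2 : WithTop ℝ≥0) < hitTime coordinate C p.1} := by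
  have : {p : PathSpace F × ℝ≥0 | (p.2 : WithTop ℝ≥0) < hitTime coordinate C p.1} =
      ⋃ n : ℕ, ⋂ k : ℕ, {p | (n : ENNReal)⁻¹ ≤
        Metric.infEDist (coordinate (min p.2 (TopologicalSpace.denseSeq ℝ≥0 k)) p.1) C} := by
    ext p
    simp only [mem_ofPred_eq, mem_iUnion, mem_iInter]
    rw [lt_hitTime_iff hC (continuous_coordinate p.1)]
    exact forall_le_notMem_iff hC p.1.2 p.2
  rw [this]
  refine .iUnion fun n ↦ .iInter fun k ↦ measurableSet_le measurable_const ?_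
  exact Metric.continuous_infEDist.measurable.comp (measurable_uncurry_coordinate.comp
    (measurable_fst.prodMk (measurable_snd.min measurable_const)))

theorem measurable_stopTime (hC : IsClosed C) :
    Measurable fun p : PathSpace F × ℝ≥0 ↦ stopTime coordinate C p.2 p.1 := by
  refine measurable_of_Ioi fun s ↦ ?_
  have : (fun p : PathSpace F × ℝ≥0 ↦ stopTime coordinate C p.2 p.1) ⁻¹' Ioi s =
      {p | s < p.2} ∩ (fun p ↦ (p.1, s)) ⁻¹'
        {p : PathSpace F × ℝ≥0 | (p.2 : WithTop ℝ≥0) < hitTime coordinate C p.1} := by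
    ext p
    simp [lt_stopTime_iff]
  rw [this]
  exact (measurableSet_lt measurable_const measurable_snd).inter
    ((measurableSet_lt_hitTime hC).preimage (measurable_fst.prodMk measurable_const))

theorem measurable_stoppedIntegrand (hC : IsClosed C) (α : ℝ) {f : F → ℝ} (hf : Measurable f) :
    Measurable (stoppedIntegrand (coordinate : ℝ≥0 → PathSpace F → F) C α f) := by
  refine Measurable.mul (by fun_prop) (hf.comp ?_)
  simp only [stoppedProcess_hitTime]
  have h : Measurable fun p : PathSpace F × ℝ ↦ (p.1, p.2.toNNReal) := by fun_prop
  exact measurable_uncurry_coordinate.comp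
    (measurable_fst.prodMk ((measurable_stopTime hC).comp h))

theorem measurable_killedIntegrand (hC : IsClosed C) (α : ℝ) {f : F → ℝ} (hf : Measurable f) :
    Measurable (killedIntegrand (coordinate : ℝ≥0 → PathSpace F → F) C α f) := by
  have h : Measurable fun p : PathSpace F × ℝ ↦ (p.1, p.2.toNNReal) := by fun_prop
  refine Measurable.indicator (Measurable.mul (by fun_prop) (hf.comp ?_))
    ((measurableSet_lt_hitTime hC).preimage h)
  exact measurable_uncurry_coordinate.comp h

end Measurability

/-! ### Exponential domination -/

section Bounds

variable {Ω F : Type*} [TopologicalSpace F] [CompactSpace F] (X : ℝ≥0 → Ω → F) (C : Set F) (α : ℝ)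
  (f : C(F, ℝ)) (p : Ω × ℝ)

theorem norm_stoppedIntegrand_le :
    ‖stoppedIntegrand X C α f p‖ ≤ Real.exp (-α * p.2) * ‖f‖ := by
  rw [stoppedIntegrand, norm_mul, Real.norm_of_nonneg (Real.exp_nonneg _)]
  exact mul_le_mul_of_nonneg_left (f.norm_coe_le_norm _) (Real.exp_nonneg _)

theorem norm_killedIntegrand_le :
    ‖killedIntegrand X C α f p‖ ≤ Real.exp (-α * p.2) * ‖f‖ := by
  refine (norm_indicator_le_norm_self _ _).trans ?_
  rw [norm_mul, Real.norm_of_nonneg (Real.exp_nonneg _)]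
  exact mul_le_mul_of_nonneg_left (f.norm_coe_le_norm _) (Real.exp_nonneg _)

end Bounds

end BarlowEvans

/-! ### Brownian motion exceeds a level as soon as it reaches it -/

namespace BrownianPath

open TopologicalSpace Filter
open scoped Topology

/-- The supremum of `b` on `[0, t]`, taken over a countable set of times. -/
def runningMax (b : ℝ≥0 → ℝ) (t : ℝ≥0) : ℝ := ⨆ k, b (min t (denseSeq ℝ≥0 k))

theorem measurable_runningMax (t : ℝ≥0) : Measurable fun b : ℝ≥0 → ℝ ↦ runningMax b t :=
  .iSup fun _ ↦ measurable_pi_apply _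

theorem runningMax_le_iff {b : ℝ≥0 → ℝ} (hb : Continuous b) {t : ℝ≥0} {c : ℝ} :
    runningMax b t ≤ c ↔ ∀ r ≤ t, b r ≤ c := by
  have hbdd : BddAbove (range fun k ↦ b (min t (denseSeq ℝ≥0 k))) := by
    refine ((isCompact_Icc (a := (0 : ℝ≥0)) (b := t)).bddAbove_image hb.continuousOn).mono ?_
    rintro _ ⟨k, rfl⟩
    exact ⟨_, ⟨zero_le, min_le_left _ _⟩, rfl⟩
  rw [runningMax, ciSup_le_iff hbdd]
  refine ⟨fun h r hr ↦ ?_, fun h k ↦ h _ (min_le_left _ _)⟩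
  have hclosed : IsClosed {s | b (min t s) ≤ c} :=
    isClosed_le (hb.comp (continuous_const.min continuous_id)) continuous_const
  have hall : {s | b (min t s) ≤ c} = univ := by
    refine hclosed.closure_eq ▸ (Dense.mono ?_ (denseRange_denseSeq ℝ≥0)).closure_eq
    rintro _ ⟨k, rfl⟩
    exact h k
  simpa [min_eq_right hr] using (eq_univ_iff_forall.1 hall r)

theorem runningMax_const_add {b : ℝ≥0 → ℝ} (hb : Continuous b) (c : ℝ) (t : ℝ≥0) :
    runningMax (fun r ↦ c + b r) t = c + runningMax b t := by
  refine eq_of_forall_ge_iff fun d ↦ ?_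
  rw [runningMax_le_iff (by fun_prop), ← le_sub_iff_add_le', runningMax_le_iff hb]
  simp only [le_sub_iff_add_le']

/-- The path exceeds the level `a` as soon as it has reached it. -/
def CrossesUp (b : ℝ≥0 → ℝ) (a : ℝ) : Prop :=
  ∀ r, b r = a → ∀ s > r, ∃ r' < s, a < b r'

section Regular

variable {Ω Ω' : Type*} [MeasurableSpace Ω] [MeasurableSpace Ω'] {Q : Measure Ω} {Q' : Measure Ω'}
  {B : ℝ≥0 → Ω → ℝ} {B' : ℝ≥0 → Ω' → ℝ}

/-- Setting the process to zero on a measurable null set makes all its paths continuous. It is then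
measurable at a dense sequence of times, hence at all times as a pointwise limit. -/
theorem exists_regular (hB : IsBrownianReal B Q) :
    ∃ W : ℝ≥0 → Ω → ℝ, (∀ t, Measurable (W t)) ∧ (∀ ω, Continuous fun t ↦ W t ω) ∧
      IsBrownianReal W Q ∧ ∀ᵐ ω ∂Q, ∀ t, W t ω = B t ω := by
  classical
  have hgood : ∀ᵐ ω ∂Q, Continuous (fun t ↦ B t ω) ∧
      ∀ k, B (denseSeq ℝ≥0 k) ω = (hB.aemeasurable (denseSeq ℝ≥0 k)).mk _ ω :=
    hB.cont.and (ae_all_iff.2 fun k ↦ (hB.aemeasurable _).ae_eq_mk)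
  obtain ⟨N, hN, hNm, hN0⟩ := exists_measurable_superset_of_null (ae_iff.1 hgood)
  have hG : ∀ ω ∉ N, Continuous (fun t ↦ B t ω) ∧
      ∀ k, B (denseSeq ℝ≥0 k) ω = (hB.aemeasurable (denseSeq ℝ≥0 k)).mk _ ω := fun ω hω ↦ by
    by_contra h
    exact hω (hN h)
  let W : ℝ≥0 → Ω → ℝ := fun t ↦ Nᶜ.indicator (B t)
  have hcont : ∀ ω, Continuous fun t ↦ W t ω := fun ω ↦ by
    by_cases h : ω ∈ N
    · simpa [W, h] using continuous_const
    · simpa [W, h] using (hG ω h).1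
  have hdense : ∀ k, Measurable (W (denseSeq ℝ≥0 k)) := fun k ↦ by
    have : W (denseSeq ℝ≥0 k) = Nᶜ.indicator ((hB.aemeasurable (denseSeq ℝ≥0 k)).mk _) :=
      indicator_congr fun ω hω ↦ (hG ω hω).2 k
    rw [this]
    exact (hB.aemeasurable _).measurable_mk.indicator hNm.compl
  have hae : ∀ᵐ ω ∂Q, ∀ t, W t ω = B t ω := by
    filter_upwards [measure_eq_zero_iff_ae_notMem.1 hN0] with ω hω t
    simp [W, hω]
  refine ⟨W, fun t ↦ ?_, hcont, ⟨hB.toIsPreBrownianReal.congr fun t ↦ ?_, .of_forall hcont⟩, hae⟩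
  · obtain ⟨x, hx, hxt⟩ := mem_closure_iff_seq_limit.1 (denseRange_denseSeq ℝ≥0 t)
    refine measurable_of_tendsto_metrizable (f := fun n ↦ W (x n)) (fun n ↦ ?_)
      (tendsto_pi_nhds.2 fun ω ↦ ((hcont ω).tendsto t).comp hxt)
    obtain ⟨k, hk⟩ := hx n
    exact hk ▸ hdense k
  · filter_upwards [hae] with ω hω using (hω t).symm

/-- Both laws on path space are projective limits of the same Gaussian marginals, and such a limit
is unique. -/
theorem identDistrib_of_isPreBrownianReal (hB : IsPreBrownianReal B Q)
    (hB' : IsPreBrownianReal B' Q') (hm : ∀ t, Measurable (B t)) (hm' : ∀ t, Measurable (B' t)) :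
    IdentDistrib (fun ω t ↦ B t ω) (fun ω t ↦ B' t ω) Q Q' := by
  have hm1 : Measurable fun ω t ↦ B t ω := measurable_pi_lambda _ hm
  have hm2 : Measurable fun ω t ↦ B' t ω := measurable_pi_lambda _ hm'
  refine ⟨hm1.aemeasurable, hm2.aemeasurable, ?_⟩
  have h1 := isProjectiveLimit_map hm1.aemeasurable (P := Q)
  have h2 := isProjectiveLimit_map hm2.aemeasurable (P := Q')
  simp only [fun I ↦ (hB.hasLaw I).map_eq] at h1
  simp only [fun I ↦ (hB'.hasLaw I).map_eq] at h2
  exact h1.unique h2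

theorem indepFun_runningMax_shift_eval (hB : IsPreBrownianReal B Q) (s v : ℝ≥0) :
    IndepFun (fun ω ↦ runningMax (fun r ↦ B (s + r) ω - B s ω) v) (B s) Q :=
  (hB.indepFun_shift s).comp (measurable_runningMax v)
    (measurable_pi_apply (⟨s, self_mem_Iic⟩ : Iic s))

theorem identDistrib_runningMax_shift (hB : IsPreBrownianReal B Q) (hm : ∀ t, Measurable (B t))
    (s v : ℝ≥0) :
    IdentDistrib (fun ω ↦ runningMax (fun r ↦ B (s + r) ω - B s ω) v)
      (fun ω ↦ runningMax (fun r ↦ B r ω) v) Q Q :=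
  (identDistrib_of_isPreBrownianReal (hB.shift s) hB (fun _ ↦ (hm _).sub (hm _)) hm).comp
    (measurable_runningMax v)

theorem gaussianReal_real_Iic_zero {v : ℝ≥0} (hv : v ≠ 0) :
    (gaussianReal 0 v).real (Iic 0) = 1 / 2 := by
  have := nullSingletonClass_gaussianReal (μ := 0) hv
  have hneg : (gaussianReal 0 v).real (Iic 0) = (gaussianReal 0 v).real (Ici 0) := by
    conv_lhs => rw [← neg_zero (G := ℝ), ← gaussianReal_map_neg, measureReal_def,
      Measure.map_apply measurable_neg measurableSet_Iic]
    simp [measureReal_def]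
  have hIoi : (gaussianReal 0 v).real (Ioi 0) = (gaussianReal 0 v).real (Ici 0) :=
    congrArg ENNReal.toReal (measure_congr Ioi_ae_eq_Ici)
  have hcompl := probReal_compl_eq_one_sub (μ := gaussianReal 0 v) (measurableSet_Iic (a := (0 : ℝ)))
  rw [compl_Iic] at hcompl
  linarith

theorem measureReal_eval_nonpos (hB : IsPreBrownianReal B Q) {s : ℝ≥0} (hs : s ≠ 0) :
    Q.real (B s ⁻¹' Iic 0) = 1 / 2 := by
  rw [← gaussianReal_real_Iic_zero hs, ← (hB.hasLaw_eval s).map_eq,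
    map_measureReal_apply_of_aemeasurable (hB.aemeasurable s) measurableSet_Iic]

theorem measureReal_le_abs_eval (hB : IsPreBrownianReal B Q) (s : ℝ≥0) {δ : ℝ} (hδ : 0 < δ) :
    Q.real {ω | δ ≤ |B s ω|} ≤ s / δ ^ 2 := by
  have := hB.isGaussianProcess.isProbabilityMeasure
  have h := meas_ge_le_variance_div_sq
    (hB.isGaussianProcess.hasGaussianLaw_eval s).memLp_two hδ
  rw [hB.integral_eval, ← covariance_self (hB.aemeasurable s), hB.covariance_eval] at h
  simp only [sub_zero, min_self] at h
  exact ENNReal.toReal_le_of_le_ofReal (by positivity) h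

/-- If the path stays nonpositive up to `s + v` and `|B s| < δ`, then `B s ≤ 0` and the increments
after `s` stay below `δ` for a time `v`. These two events are independent, the first having
probability `1 / 2`; Chebyshev's inequality bounds the excluded event. -/
theorem measureReal_runningMax_nonpos_le_add (hB : IsBrownianReal B Q)
    (hm : ∀ t, Measurable (B t)) (hc : ∀ ω, Continuous fun t ↦ B t ω) {s v : ℝ≥0} (hs : s ≠ 0)
    {δ : ℝ} (hδ : 0 < δ) :
    Q.real {ω | runningMax (fun r ↦ B r ω) (s + v) ≤ 0} ≤
      s / δ ^ 2 + 1 / 2 * Q.real {ω | runningMax (fun r ↦ B r ω) v ≤ δ} := by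
  have := hB.isGaussianProcess.isProbabilityMeasure
  set M : Ω → ℝ := fun ω ↦ runningMax (fun r ↦ B (s + r) ω - B s ω) v
  have hsub : {ω | runningMax (fun r ↦ B r ω) (s + v) ≤ 0} ⊆
      {ω | δ ≤ |B s ω|} ∪ (M ⁻¹' Iic δ ∩ B s ⁻¹' Iic 0) := fun ω hω ↦ by
    rw [mem_ofPred_eq, runningMax_le_iff (hc ω)] at hω
    by_cases h : δ ≤ |B s ω|
    · exact .inl h
    · refine .inr ⟨?_, hω s le_self_add⟩
      have hcω := hc ω
      refine (runningMax_le_iff (by fun_prop)).2 fun r hr ↦ ?_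
      have h1 := hω (s + r) (by gcongr)
      have h2 := (abs_lt.1 (not_le.1 h)).1
      linarith
  have hind : Q.real (M ⁻¹' Iic δ ∩ B s ⁻¹' Iic 0) =
      Q.real (M ⁻¹' Iic δ) * Q.real (B s ⁻¹' Iic 0) := by
    rw [measureReal_def, (indepFun_runningMax_shift_eval hB.toIsPreBrownianReal s v)
      |>.measure_inter_preimage_eq_mul _ _ measurableSet_Iic measurableSet_Iic, ENNReal.toReal_mul]
    rfl
  have hlaw : Q.real (M ⁻¹' Iic δ) = Q.real {ω | runningMax (fun r ↦ B r ω) v ≤ δ} :=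
    congrArg ENNReal.toReal ((identDistrib_runningMax_shift hB.toIsPreBrownianReal hm s v)
      |>.measure_mem_eq measurableSet_Iic)
  refine (measureReal_mono hsub).trans ((measureReal_union_le _ _).trans ?_)
  rw [hind, hlaw, measureReal_eval_nonpos hB.toIsPreBrownianReal hs, mul_comm (1 / 2 : ℝ)]
  gcongr
  exact measureReal_le_abs_eval hB.toIsPreBrownianReal s hδ

/-- In the preceding bound both `s` and `δ` tend to `0`; right continuity of the distribution
function of the maximum allows the passage to `δ = 0`. Iterating over halved times then forces the
probability to vanish. -/
theorem measureReal_runningMax_nonpos_le_half (hB : IsBrownianReal B Q)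
    (hm : ∀ t, Measurable (B t)) (hc : ∀ ω, Continuous fun t ↦ B t ω) {t : ℝ≥0} (ht : t ≠ 0) :
    Q.real {ω | runningMax (fun r ↦ B r ω) t ≤ 0} ≤
      1 / 2 * Q.real {ω | runningMax (fun r ↦ B r ω) (t / 2) ≤ 0} := by
  have := hB.isGaussianProcess.isProbabilityMeasure
  set M : Ω → ℝ := fun ω ↦ runningMax (fun r ↦ B r ω) (t / 2)
  have hM : Measurable M := (measurable_runningMax _).comp (measurable_pi_lambda _ hm)
  have := Measure.isProbabilityMeasure_map (μ := Q) hM.aemeasurable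
  have hcdf : ∀ δ, Q.real {ω | M ω ≤ δ} = cdf (Q.map M) δ := fun δ ↦ by
    rw [cdf_eq_real, map_measureReal_apply hM measurableSet_Iic]
    rfl
  have hbound : ∀ δ : ℝ, 0 < δ →
      Q.real {ω | runningMax (fun r ↦ B r ω) t ≤ 0} ≤ δ + 1 / 2 * cdf (Q.map M) δ := by
    intro δ hδ
    -- The cube makes the Chebyshev term `s / δ ^ 2` at most `δ`; the bound `t / 2` keeps `s + t /
    -- 2` within `[0, t]`.
    set s : ℝ≥0 := min (t / 2) (δ ^ 3).toNNReal
    have hs : s ≠ 0 := (lt_min (by positivity) (Real.toNNReal_pos.2 (by positivity))).ne'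
    have hsδ : (s : ℝ) ≤ δ ^ 3 := by
      refine (NNReal.coe_le_coe.2 (min_le_right _ _)).trans ?_
      rw [Real.coe_toNNReal _ (by positivity)]
    have hst : s + t / 2 ≤ t := (add_le_add_left (min_le_left _ _) _).trans (add_halves t).le
    have hmono : {ω | runningMax (fun r ↦ B r ω) t ≤ 0} ⊆
        {ω | runningMax (fun r ↦ B r ω) (s + t / 2) ≤ 0} := fun ω hω ↦
      (runningMax_le_iff (hc ω)).2 fun r hr ↦ (runningMax_le_iff (hc ω)).1 hω r (hr.trans hst)
    refine (measureReal_mono hmono).trans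
      ((measureReal_runningMax_nonpos_le_add hB hm hc hs hδ).trans ?_)
    rw [hcdf]
    gcongr
    rw [div_le_iff₀ (by positivity)]
    linarith
  have hlim : Tendsto (fun δ ↦ δ + 1 / 2 * cdf (Q.map M) δ) (𝓝[>] 0)
      (𝓝 (0 + 1 / 2 * cdf (Q.map M) 0)) :=
    (tendsto_id.mono_left nhdsWithin_le_nhds).add
      ((((cdf (Q.map M)).right_continuous 0).mono Ioi_subset_Ici_self).tendsto.const_mul _)
  rw [hcdf]
  rw [zero_add] at hlim
  exact ge_of_tendsto hlim (eventually_nhdsWithin_of_forall hbound)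

theorem ae_runningMax_pos (hB : IsBrownianReal B Q)
    (hm : ∀ t, Measurable (B t)) (hc : ∀ ω, Continuous fun t ↦ B t ω) {t : ℝ≥0} (ht : t ≠ 0) :
    ∀ᵐ ω ∂Q, 0 < runningMax (fun r ↦ B r ω) t := by
  have := hB.isGaussianProcess.isProbabilityMeasure
  have hpow : ∀ n : ℕ, ∀ t : ℝ≥0, t ≠ 0 →
      Q.real {ω | runningMax (fun r ↦ B r ω) t ≤ 0} ≤ (1 / 2) ^ n := by
    intro n
    induction n with
    | zero => exact fun t _ ↦ by simp
    | succ n ih =>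
      intro t ht
      refine (measureReal_runningMax_nonpos_le_half hB hm hc ht).trans ?_
      rw [pow_succ']
      gcongr
      exact ih _ (by positivity)
  have hzero : Q.real {ω | runningMax (fun r ↦ B r ω) t ≤ 0} = 0 :=
    le_antisymm (ge_of_tendsto' (tendsto_pow_atTop_nhds_zero_of_lt_one (by norm_num)
      (by norm_num)) fun n ↦ hpow n t ht) measureReal_nonneg
  simpa [ae_iff] using (measureReal_eq_zero_iff).1 hzero

/-- The maximum over `[s, s + v]` is `B s` plus an independent variable, and `B s` has no atoms, so
neither does the sum. -/
theorem ae_runningMax_shift_ne (hB : IsPreBrownianReal B Q) (hm : ∀ t, Measurable (B t))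
    (hc : ∀ ω, Continuous fun t ↦ B t ω) {s : ℝ≥0} (hs : s ≠ 0) (v : ℝ≥0) (a : ℝ) :
    ∀ᵐ ω ∂Q, runningMax (fun r ↦ B (s + r) ω) v ≠ a := by
  have := hB.isGaussianProcess.isProbabilityMeasure
  have := nullSingletonClass_gaussianReal (μ := 0) hs
  set M : Ω → ℝ := fun ω ↦ runningMax (fun r ↦ B (s + r) ω - B s ω) v
  have hM : Measurable M :=
    (measurable_runningMax _).comp (measurable_pi_lambda _ fun _ ↦ (hm _).sub (hm _))
  have hprod := (indepFun_iff_map_prod_eq_prod_map_map hM.aemeasurable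
    (hm s).aemeasurable).1 (indepFun_runningMax_shift_eval hB s v)
  have hset : MeasurableSet {p : ℝ × ℝ | p.1 + p.2 = a} :=
    measurableSet_eq_fun (by fun_prop) measurable_const
  have hnull : (Q.map fun ω ↦ (M ω, B s ω)) {p : ℝ × ℝ | p.1 + p.2 = a} = 0 := by
    have := Measure.isProbabilityMeasure_map (μ := Q) hM.aemeasurable
    rw [hprod, (hB.hasLaw_eval s).map_eq, Measure.measure_prod_null hset]
    refine .of_forall fun x ↦ ?_
    have : Prod.mk x ⁻¹' {p : ℝ × ℝ | p.1 + p.2 = a} = {a - x} := by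
      ext y
      simp [eq_sub_iff_add_eq']
    simp only [this, measure_singleton, Pi.zero_apply]
  rw [Measure.map_apply (hM.prodMk (hm s)) hset] at hnull
  filter_upwards [measure_eq_zero_iff_ae_notMem.1 hnull] with ω hω h
  refine hω ?_
  have hcω := hc ω
  rw [mem_preimage, mem_ofPred_eq, ← h, add_comm, ← runningMax_const_add (by fun_prop)]
  simp

theorem ae_crossesUp (hB : IsBrownianReal B Q) (hm : ∀ t, Measurable (B t))
    (hc : ∀ ω, Continuous fun t ↦ B t ω) {a : ℝ} (ha : 0 ≤ a) :
    ∀ᵐ ω ∂Q, CrossesUp (fun t ↦ B t ω) a := by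
  have hpos : ∀ᵐ ω ∂Q, ∀ k, denseSeq ℝ≥0 k ≠ 0 →
      0 < runningMax (fun r ↦ B r ω) (denseSeq ℝ≥0 k) :=
    ae_all_iff.2 fun k ↦ Filter.eventually_imp_distrib_left.2 fun h ↦ ae_runningMax_pos hB hm hc h
  have hne : ∀ᵐ ω ∂Q, ∀ j k, denseSeq ℝ≥0 j ≠ 0 →
      runningMax (fun r ↦ B (denseSeq ℝ≥0 j + r) ω) (denseSeq ℝ≥0 k - denseSeq ℝ≥0 j) ≠ a :=
    ae_all_iff.2 fun j ↦ ae_all_iff.2 fun k ↦ Filter.eventually_imp_distrib_left.2 fun h ↦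
      ae_runningMax_shift_ne hB.toIsPreBrownianReal hm hc h _ a
  filter_upwards [hpos, hne, hB.eval_zero_ae_eq_zero] with ω hpos hne h0 r hr s hs
  change B r ω = a at hr
  have hcω := hc ω
  by_contra! hcon
  have hdense : ∀ {x y : ℝ≥0}, x < y → ∃ k, denseSeq ℝ≥0 k ∈ Ioo x y := fun h ↦ by
    simpa using (denseRange_denseSeq ℝ≥0).exists_mem_open isOpen_Ioo (nonempty_Ioo.2 h)
  -- A failure bounds the path by `a` before time `s`. For `a = 0` this contradicts positivity of
  -- the running maximum. For `a > 0` the visit time `r` is positive, so there are dense times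
  -- around it, and the maximum between them is exactly `a`.
  rcases ha.eq_or_lt with rfl | ha
  · obtain ⟨k, hk⟩ := hdense (zero_le.trans_lt hs)
    refine (hpos k hk.1.ne').not_ge ((runningMax_le_iff hcω).2 fun r' hr' ↦ ?_)
    exact hcon r' (hr'.trans_lt hk.2)
  · have hr0 : 0 < r := pos_iff_ne_zero.2 fun h ↦ by
      rw [h, h0] at hr
      exact ha.ne hr
    obtain ⟨j, hj⟩ := hdense hr0
    obtain ⟨k, hk⟩ := hdense hs
    have hjk : denseSeq ℝ≥0 j ≤ denseSeq ℝ≥0 k := (hj.2.trans hk.1).le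
    refine hne j k hj.1.ne' (eq_of_forall_ge_iff fun c ↦ ?_)
    rw [runningMax_le_iff (by fun_prop)]
    refine ⟨fun h ↦ ?_, fun h r' hr' ↦ (hcon _ ?_).trans h⟩
    · have := h (r - denseSeq ℝ≥0 j) (by gcongr; exact hk.1.le)
      rwa [add_tsub_cancel_of_le hj.2.le, hr] at this
    · refine lt_of_le_of_lt ?_ hk.2
      exact (add_le_add_right hr' _).trans (add_tsub_cancel_of_le hjk).le

end Regular
end BrownianPath

/-! ### Pathwise continuity of the hitting time in the starting point -/

namespace ReflectedBM

open BarlowEvans BrownianPath Filter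
open scoped Topology

theorem continuous_fold : Continuous fold := by
  refine Continuous.subtype_mk ?_ _
  have h : ∀ y : ℝ, |y - 2 * (round (y / 2) : ℝ)| = 2 * ‖((y / 2 : ℝ) : UnitAddCircle)‖ := fun y ↦ by
    rw [UnitAddCircle.norm_eq, ← abs_two (α := ℝ), ← abs_mul, abs_two]
    congr 1
    ring
  simp only [h]
  exact continuous_const.mul (continuous_norm.comp
    ((AddCircle.continuous_mk' 1).comp (continuous_id.div_const 2)))

theorem countable_preimage_fold {C : Set unitInterval} (hC : C.Countable) :
    (fold ⁻¹' C).Countable := by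
  refine (hC.biUnion fun c _ ↦ countable_iUnion fun k : ℤ ↦
    ((countable_singleton (2 * k - (c : ℝ))).insert (2 * k + (c : ℝ)))).mono fun y hy ↦ ?_
  simp only [mem_iUnion]
  refine ⟨fold y, hy, round (y / 2), ?_⟩
  have h : ((fold y : unitInterval) : ℝ) = |y - 2 * (round (y / 2) : ℝ)| := rfl
  rw [h]
  rcases abs_cases (y - 2 * (round (y / 2) : ℝ)) with ⟨h1, _⟩ | ⟨h1, _⟩
  · exact .inl (by rw [h1]; ring)
  · exact .inr (by rw [h1, mem_singleton_iff]; ring)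

/-- The path `fold (x + σ b)`. -/
def reflectedPath (σ : ℝ) {b : ℝ≥0 → ℝ} (hb : Continuous b) (x : unitInterval) :
    PathSpace unitInterval :=
  ⟨fun t ↦ fold ((x : ℝ) + σ * b t), continuous_fold.comp (by fun_prop)⟩

variable {σ : ℝ} {b : ℝ≥0 → ℝ} {C : Set unitInterval} {x : unitInterval}

theorem continuous_uncurry_reflectedPath (hb : Continuous b) :
    Continuous fun p : unitInterval × ℝ≥0 ↦ coordinate p.2 (reflectedPath σ hb p.1) :=
  continuous_fold.comp (by fun_prop)

theorem tendsto_coordinate_reflectedPath (hb : Continuous b) {τ : unitInterval → ℝ≥0} {s : ℝ≥0}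
    (hτ : Tendsto τ (𝓝 x) (𝓝 s)) :
    Tendsto (fun x' ↦ coordinate (τ x') (reflectedPath σ hb x')) (𝓝 x)
      (𝓝 (coordinate s (reflectedPath σ hb x))) :=
  have h : Tendsto (fun x' ↦ (x', τ x')) (𝓝 x) (𝓝 (x, s)) := tendsto_id.prodMk_nhds hτ
  ((continuous_uncurry_reflectedPath hb).tendsto (x, s)).comp h

theorem coordinate_reflectedPath (hb : Continuous b) (t : ℝ≥0) :
    coordinate t (reflectedPath σ hb x) = fold ((x : ℝ) + σ * b t) := rfl

/-- The path `b` crosses, in the direction away from `0`, all levels at which `x + σ b` visits the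
preimage of `C` under folding. -/
def CrossesLevels (σ : ℝ) (b : ℝ≥0 → ℝ) (C : Set unitInterval) (x : unitInterval) : Prop :=
  ∀ d ∈ fold ⁻¹' C, (0 ≤ (d - x) / σ → CrossesUp b ((d - x) / σ)) ∧
    (0 ≤ -((d - x) / σ) → CrossesUp (fun t ↦ -b t) (-((d - x) / σ)))

/-- Lower semicontinuity of the hitting time: avoidance of `C` is open jointly in starting point and
time, and `[0, s]` is compact. -/
theorem eventually_lt_hitTime (hb : Continuous b) (hC : IsClosed C) {s : ℝ≥0}
    (hs : (s : WithTop ℝ≥0) < hitTime coordinate C (reflectedPath σ hb x)) :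
    ∀ᶠ x' in 𝓝 x, (s : WithTop ℝ≥0) < hitTime coordinate C (reflectedPath σ hb x') := by
  simp only [lt_hitTime_iff hC (continuous_coordinate _)] at hs ⊢
  have := (isCompact_Icc (a := (0 : ℝ≥0)) (b := s)).eventually_forall_of_forall_eventually
    (x₀ := x) (P := fun x' r ↦ coordinate r (reflectedPath σ hb x') ∉ C) fun r hr ↦
      (hC.isOpen_compl.preimage (continuous_uncurry_reflectedPath hb)).eventually_mem (hs r hr.2)
  filter_upwards [this] with x' hx' r hr using hx' r ⟨zero_le, hr⟩

theorem exists_coordinate_mem_of_cross (hb : Continuous b) (h0 : b 0 = 0) {d : ℝ}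
    (hd : d ∈ fold ⁻¹' C) {s r : ℝ≥0} (hr : r < s)
    (h : d ∈ uIcc (x : ℝ) (x + σ * b r)) :
    ∃ r < s, coordinate r (reflectedPath σ hb x) ∈ C := by
  have hcont : Continuous fun t ↦ (x : ℝ) + σ * b t := by fun_prop
  have hsub := isPreconnected_Icc (a := (0 : ℝ≥0)) (b := r) |>.image _ hcont.continuousOn
  have hmem : d ∈ (fun t ↦ (x : ℝ) + σ * b t) '' Icc 0 r := by
    refine hsub.ordConnected.uIcc_subset (x := x) ⟨0, by simp, by simp [h0]⟩ ⟨r, by simp, rfl⟩ h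
  obtain ⟨t, ht, htd⟩ := hmem
  refine ⟨t, ht.2.trans_lt hr, ?_⟩
  rw [coordinate_reflectedPath, show (x : ℝ) + σ * b t = d from htd]
  exact hd

/-- Upper semicontinuity of the hitting time: the path from `x` strictly overshoots the level `d`
before `s`. The overshoot survives a small change of starting point, so the path from `x'` has `d`
between its start and a later value. -/
theorem eventually_exists_coordinate_mem (hσ : 0 < σ) (hb : Continuous b) (h0 : b 0 = 0)
    (hcross : CrossesLevels σ b C x) {s r : ℝ≥0} (hr : r < s)
    (hrC : coordinate r (reflectedPath σ hb x) ∈ C) :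
    ∀ᶠ x' in 𝓝 x, ∃ r < s, coordinate r (reflectedPath σ hb x') ∈ C := by
  set d : ℝ := x + σ * b r
  have hd : d ∈ fold ⁻¹' C := hrC
  have ha : (d - x) / σ = b r := by simp [d, hσ.ne']
  obtain ⟨hup, hdown⟩ := hcross d hd
  rw [ha] at hup hdown
  have hcoe : Tendsto (fun x' : unitInterval ↦ (x' : ℝ)) (𝓝 x) (𝓝 x) :=
    continuous_subtype_val.tendsto x
  have hright : 0 ≤ b r → ∀ᶠ x' : unitInterval in 𝓝 x, (x' : ℝ) ≤ d →
      ∃ r < s, coordinate r (reflectedPath σ hb x') ∈ C := fun h ↦ by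
    obtain ⟨r', hr', hlt⟩ := hup h r rfl s hr
    have hlt' : d - σ * b r' < x := by
      have := mul_lt_mul_of_pos_left hlt hσ
      simp only [d]
      linarith
    filter_upwards [hcoe.eventually_const_lt hlt'] with x' hx' hle
    exact exists_coordinate_mem_of_cross hb h0 hd hr' (mem_uIcc.2 (.inl ⟨hle, by linarith⟩))
  have hleft : 0 ≤ -b r → ∀ᶠ x' : unitInterval in 𝓝 x, d ≤ (x' : ℝ) →
      ∃ r < s, coordinate r (reflectedPath σ hb x') ∈ C := fun h ↦ by
    obtain ⟨r', hr', hlt⟩ := hdown h r rfl s hr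
    have hlt' : (x : ℝ) < d - σ * b r' := by
      have := mul_lt_mul_of_pos_left hlt hσ
      simp only [d]
      linarith
    filter_upwards [hcoe.eventually_lt_const hlt'] with x' hx' hle
    exact exists_coordinate_mem_of_cross hb h0 hd hr' (mem_uIcc.2 (.inr ⟨by linarith, hle⟩))
  -- The sign of `b r` decides on which side of `d` the nearby starting points lie. For `b r = 0`
  -- the level is `x` itself, both sides occur, and the path must cross in both directions.
  rcases lt_trichotomy (b r) 0 with h | h | h
  · have hlt : d < x := by
      have := mul_neg_of_pos_of_neg hσ h
      simp only [d]
      linarith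
    filter_upwards [hleft (by linarith), hcoe.eventually_const_lt hlt] with x' h1 h2 using h1 h2.le
  · filter_upwards [hleft (by linarith), hright h.ge] with x' h1 h2
    exact (le_total d x').elim h1 h2
  · have hlt : x < d := by
      have := mul_pos hσ h
      simp only [d]
      linarith
    filter_upwards [hright h.le, hcoe.eventually_lt_const hlt] with x' h1 h2 using h1 h2.le

theorem eventually_hitTime_lt (hσ : 0 < σ) (hb : Continuous b) (h0 : b 0 = 0)
    (hcross : CrossesLevels σ b C x) {s : ℝ≥0}
    (hs : hitTime coordinate C (reflectedPath σ hb x) < s) :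
    ∀ᶠ x' in 𝓝 x, hitTime coordinate C (reflectedPath σ hb x') < s := by
  simp only [hitTime_lt_iff] at hs ⊢
  obtain ⟨r, hr, hrC⟩ := hs
  exact eventually_exists_coordinate_mem hσ hb h0 hcross hr hrC

theorem tendsto_stopTime (hσ : 0 < σ) (hb : Continuous b) (h0 : b 0 = 0) (hC : IsClosed C)
    (hcross : CrossesLevels σ b C x) (t : ℝ≥0) :
    Tendsto (fun x' ↦ stopTime coordinate C t (reflectedPath σ hb x')) (𝓝 x)
      (𝓝 (stopTime coordinate C t (reflectedPath σ hb x))) := by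
  refine tendsto_order.2 ⟨fun s hs ↦ ?_, fun s hs ↦ ?_⟩
  · simp only [lt_stopTime_iff] at hs ⊢
    exact (eventually_lt_hitTime hb hC hs.2).mono fun _ h ↦ ⟨hs.1, h⟩
  · simp only [stopTime_lt_iff] at hs ⊢
    rcases hs with hs | hs
    · exact .of_forall fun _ ↦ .inl hs
    · exact (eventually_hitTime_lt hσ hb h0 hcross hs).mono fun _ ↦ .inr

theorem tendsto_stoppedIntegrand (hσ : 0 < σ) (hb : Continuous b) (h0 : b 0 = 0) (hC : IsClosed C)
    (hcross : CrossesLevels σ b C x) (α : ℝ) (f : C(unitInterval, ℝ)) (t : ℝ) :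
    Tendsto (fun x' ↦ stoppedIntegrand coordinate C α f (reflectedPath σ hb x', t)) (𝓝 x)
      (𝓝 (stoppedIntegrand coordinate C α f (reflectedPath σ hb x, t))) := by
  refine Tendsto.const_mul _ ((f.continuous.tendsto _).comp ?_)
  exact tendsto_coordinate_reflectedPath hb (tendsto_stopTime hσ hb h0 hC hcross _)

theorem tendsto_killedIntegrand (hσ : 0 < σ) (hb : Continuous b) (h0 : b 0 = 0) (hC : IsClosed C)
    (hcross : CrossesLevels σ b C x) (α : ℝ) (f : C(unitInterval, ℝ)) {t : ℝ}
    (ht : (t.toNNReal : WithTop ℝ≥0) ≠ hitTime coordinate C (reflectedPath σ hb x)) :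
    Tendsto (fun x' ↦ killedIntegrand coordinate C α f (reflectedPath σ hb x', t)) (𝓝 x)
      (𝓝 (killedIntegrand coordinate C α f (reflectedPath σ hb x, t))) := by
  rcases ht.lt_or_gt with ht | ht
  · have hval : ∀ x', (t.toNNReal : WithTop ℝ≥0) < hitTime coordinate C (reflectedPath σ hb x') →
        killedIntegrand coordinate C α f (reflectedPath σ hb x', t) =
          Real.exp (-α * t) * f (coordinate t.toNNReal (reflectedPath σ hb x')) := fun x' h ↦
      indicator_of_mem (by exact h) _
    rw [hval x ht]
    refine Tendsto.congr' ((eventually_lt_hitTime hb hC ht).mono fun x' h ↦ (hval x' h).symm) ?_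
    refine Tendsto.const_mul _ ((f.continuous.tendsto _).comp ?_)
    exact tendsto_coordinate_reflectedPath hb tendsto_const_nhds
  · have hev := eventually_hitTime_lt hσ hb h0 hcross ht
    have hzero : ∀ x', hitTime coordinate C (reflectedPath σ hb x') < (t.toNNReal : WithTop ℝ≥0) →
        killedIntegrand coordinate C α f (reflectedPath σ hb x', t) = 0 := fun x' h ↦
      indicator_of_notMem (by exact h.not_gt) _
    rw [hzero x ht]
    exact tendsto_const_nhds.congr' (hev.mono fun x' h ↦ (hzero x' h).symm)

theorem ae_ne_hitTime (w : PathSpace unitInterval) :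
    ∀ᵐ t ∂(volume.restrict (Ioi (0 : ℝ))), (t.toNNReal : WithTop ℝ≥0) ≠ hitTime coordinate C w := by
  rcases eq_or_ne (hitTime coordinate C w) ⊤ with h | h
  · exact .of_forall fun t ↦ h ▸ WithTop.coe_ne_top
  · lift hitTime coordinate C w to ℝ≥0 using h with T
    filter_upwards [ae_restrict_mem measurableSet_Ioi,
      ae_restrict_of_ae (measure_eq_zero_iff_ae_notMem.1 (measure_singleton (T : ℝ)))] with t ht hne heq
    refine hne ?_
    rw [mem_singleton_iff, ← WithTop.coe_injective heq, Real.coe_toNNReal _ (le_of_lt ht)]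

end ReflectedBM

/-! ### Coupling of the laws and continuity of the resolvents -/

namespace ReflectedBM

open BarlowEvans BrownianPath Filter
open scoped Topology

open Classical in
/-- The path of `X`, replaced by a constant one where it is not continuous. -/
def toPath {Ω : Type*} (X : ℝ≥0 → Ω → unitInterval) (ω : Ω) : PathSpace unitInterval :=
  if h : Continuous fun t ↦ X t ω then ⟨fun t ↦ X t ω, h⟩ else ⟨fun _ ↦ 0, continuous_const⟩

theorem coordinate_toPath {Ω : Type*} {X : ℝ≥0 → Ω → unitInterval} {ω : Ω}
    (h : Continuous fun t ↦ X t ω) (t : ℝ≥0) : coordinate t (toPath X ω) = X t ω := by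
  simp [coordinate, toPath, h]

/-- Every measurable set of the subtype is the trace of one in `E`. This carries equality in law
from the product space to the space of continuous paths, which need not be a measurable subset of
it. -/
theorem identDistrib_of_subtype_val {Ω Ω' E : Type*} [MeasurableSpace Ω] [MeasurableSpace Ω']
    [MeasurableSpace E] {p : E → Prop} {μ : Measure Ω} {ν : Measure Ω'} {f : Ω → Subtype p}
    {g : Ω' → Subtype p} (h : IdentDistrib (fun ω ↦ (f ω : E)) (fun ω ↦ (g ω : E)) μ ν) :
    IdentDistrib f g μ ν := by
  have hf : AEMeasurable f μ :=
    h.aemeasurable_fst.subtype_mk (s := {e | p e}) (hfs := fun ω ↦ (f ω).2)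
  have hg : AEMeasurable g ν :=
    h.aemeasurable_snd.subtype_mk (s := {e | p e}) (hfs := fun ω ↦ (g ω).2)
  refine ⟨hf, hg, Measure.ext fun S hS ↦ ?_⟩
  obtain ⟨A, hA, rfl⟩ := hS
  rw [Measure.map_apply_of_aemeasurable hf (measurable_subtype_coe hA),
    Measure.map_apply_of_aemeasurable hg (measurable_subtype_coe hA)]
  exact h.measure_mem_eq hA

variable {Ω : Type*} [MeasurableSpace Ω] {σ : ℝ} {X : ℝ≥0 → Ω → unitInterval}
  {P : unitInterval → Measure Ω}

/-- All laws `P x` are realised by reflecting one Brownian motion. -/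
theorem IsReflectedBrownianMotion.exists_coupling (hX : IsReflectedBrownianMotion σ X P) :
    ∃ (Ω' : Type) (_ : MeasurableSpace Ω') (Q : Measure Ω') (W : ℝ≥0 → Ω' → ℝ)
      (hc : ∀ ω, Continuous fun t ↦ W t ω), (∀ t, Measurable (W t)) ∧ IsBrownianReal W Q ∧
      ∀ x, IdentDistrib (toPath X) (fun ω ↦ reflectedPath σ (hc ω) x) (P x) Q := by
  obtain ⟨Ω', _, Q, B, hB, -⟩ := hX.law 0
  obtain ⟨W, hm, hc, hW, -⟩ := exists_regular hB
  refine ⟨Ω', _, Q, W, hc, hm, hW, fun x ↦ identDistrib_of_subtype_val ?_⟩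
  -- The Brownian motion supplied for `x` may differ from the one for `0`, but the two have the same
  -- law, hence so do their reflections started at `x`.
  obtain ⟨Ω₁, _, Q₁, B₁, hB₁, hlaw⟩ := hX.law x
  obtain ⟨W₁, hm₁, hc₁, hW₁, hae⟩ := exists_regular hB₁
  have hmeas : Measurable fun (b : ℝ≥0 → ℝ) (t : ℝ≥0) ↦ fold ((x : ℝ) + σ * b t) :=
    measurable_pi_lambda _ fun t ↦ continuous_fold.measurable.comp (by fun_prop)
  have h₁ : IdentDistrib (fun ω t ↦ fold ((x : ℝ) + σ * B₁ t ω))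
      (fun ω t ↦ fold ((x : ℝ) + σ * W₁ t ω)) Q₁ Q₁ :=
    .of_ae_eq hlaw.aemeasurable_snd (hae.mono fun ω h ↦ by simp only [h])
  have h₂ := (identDistrib_of_isPreBrownianReal hW₁.toIsPreBrownianReal hW.toIsPreBrownianReal
    hm₁ hm).comp hmeas
  refine (IdentDistrib.trans (.symm (.of_ae_eq hlaw.aemeasurable_fst ?_)) hlaw).trans
    (h₁.trans h₂)
  filter_upwards [hX.continuous_paths x] with ω hω
  exact funext fun t ↦ (coordinate_toPath hω t).symm

theorem ae_crossesLevels {Ω' : Type*} [MeasurableSpace Ω'] {Q : Measure Ω'} {W : ℝ≥0 → Ω' → ℝ}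
    (hW : IsBrownianReal W Q) (hm : ∀ t, Measurable (W t)) (hc : ∀ ω, Continuous fun t ↦ W t ω)
    (σ : ℝ) {C : Set unitInterval} (hC : C.Countable) (x : unitInterval) :
    ∀ᵐ ω ∂Q, CrossesLevels σ (fun t ↦ W t ω) C x := by
  refine (ae_ball_iff (countable_preimage_fold hC)).2 fun d _ ↦ ?_
  refine (eventually_imp_distrib_left.2 fun h ↦ ae_crossesUp hW hm hc h).and
    (eventually_imp_distrib_left.2 fun h ↦ ?_)
  exact ae_crossesUp hW.neg (fun t ↦ (hm t).neg) (fun ω ↦ (hc ω).neg) h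

theorem integrable_exp_mul_prod {Ω' : Type*} [MeasurableSpace Ω'] (μ : Measure Ω')
    [IsFiniteMeasure μ] {α : ℝ} (hα : 0 < α) (K : ℝ) :
    Integrable (fun p : Ω' × ℝ ↦ Real.exp (-α * p.2) * K)
      (μ.prod (volume.restrict (Ioi (0 : ℝ)))) := by
  have h := (integrable_const (μ := μ) (1 : ℝ)).mul_prod
    ((exp_neg_integrableOn_Ioi 0 hα).mul_const K)
  simpa using h

/-- The resolvent associated with a measurable functional `G` of the path and time preserves
continuity if `G` is almost surely continuous in the starting point of the coupled paths. -/
theorem IsReflectedBrownianMotion.integrable_and_continuous_integral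
    (hX : IsReflectedBrownianMotion σ X P) {C : Set unitInterval} (hC : C.Countable)
    {G : PathSpace unitInterval × ℝ → ℝ} (hG : Measurable G) {α K : ℝ} (hα : 0 < α)
    (hbound : ∀ p, ‖G p‖ ≤ Real.exp (-α * p.2) * K)
    (htendsto : ∀ (b : ℝ≥0 → ℝ) (hb : Continuous b), b 0 = 0 → ∀ x, CrossesLevels σ b C x →
      ∀ᵐ t ∂(volume.restrict (Ioi (0 : ℝ))),
        Tendsto (fun x' ↦ G (reflectedPath σ hb x', t)) (𝓝 x) (𝓝 (G (reflectedPath σ hb x, t))))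
    {g : Ω × ℝ → ℝ} (hg : ∀ ω, (Continuous fun t ↦ X t ω) → ∀ t, g (ω, t) = G (toPath X ω, t)) :
    (∀ x, Integrable g ((P x).prod (volume.restrict (Ioi (0 : ℝ))))) ∧
      Continuous fun x ↦ ∫ ω, (∫ t in Ioi (0 : ℝ), g (ω, t)) ∂(P x) := by
  obtain ⟨Ω', _, Q, W, hc, hm, hW, hlaw⟩ := hX.exists_coupling
  have hQ : IsProbabilityMeasure Q := hW.isGaussianProcess.isProbabilityMeasure
  -- The total mass of `P x` is read off from the equality of its image with that of `Q`.
  have hP : ∀ x, IsProbabilityMeasure (P x) := fun x ↦ by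
    have := Measure.isProbabilityMeasure_map (hlaw x).aemeasurable_snd
    rw [← (hlaw x).map_eq] at this
    exact Measure.isProbabilityMeasure_of_map (toPath X)
  have hΦ : Measurable fun w ↦ ∫ t in Ioi (0 : ℝ), G (w, t) :=
    (hG.stronglyMeasurable.integral_prod_right').measurable
  have hexp : Integrable (fun t ↦ Real.exp (-α * t) * K) (volume.restrict (Ioi (0 : ℝ))) :=
    (exp_neg_integrableOn_Ioi 0 hα).mul_const K
  refine ⟨fun x ↦ ?_, ?_⟩
  · have hmeas : AEMeasurable (fun p : Ω × ℝ ↦ G (toPath X p.1, p.2))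
        ((P x).prod (volume.restrict (Ioi (0 : ℝ)))) :=
      hG.comp_aemeasurable (((hlaw x).aemeasurable_fst.comp_quasiMeasurePreserving
        Measure.quasiMeasurePreserving_fst).prodMk measurable_snd.aemeasurable)
    refine ((integrable_exp_mul_prod (P x) hα K).mono' hmeas.aestronglyMeasurable
      (.of_forall fun p ↦ hbound _)).congr ?_
    filter_upwards [Measure.quasiMeasurePreserving_fst.ae (hX.continuous_paths x)] with p hp
    exact (hg p.1 hp p.2).symm
  · have heq : (fun x ↦ ∫ ω, (∫ t in Ioi (0 : ℝ), g (ω, t)) ∂(P x)) =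
        fun x ↦ ∫ ω, (∫ t in Ioi (0 : ℝ), G (reflectedPath σ (hc ω) x, t)) ∂Q := funext fun x ↦ by
      refine Eq.trans (integral_congr_ae ?_) ((hlaw x).comp hΦ).integral_eq
      filter_upwards [hX.continuous_paths x] with ω hω
      simp only [hg ω hω, Function.comp_apply]
    rw [heq]
    refine continuous_iff_continuousAt.2 fun x ↦ ?_
    refine tendsto_integral_filter_of_dominated_convergence
      (fun _ ↦ ∫ t in Ioi (0 : ℝ), Real.exp (-α * t) * K) (.of_forall fun x' ↦ ?_)
      (.of_forall fun x' ↦ .of_forall fun ω ↦ ?_) (integrable_const _) ?_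
    · exact (hΦ.comp_aemeasurable (hlaw x').aemeasurable_snd).aestronglyMeasurable
    · exact norm_integral_le_of_norm_le hexp (.of_forall fun t ↦ hbound _)
    -- The exceptional null set may depend on `x`, which is harmless since continuity is proved at
    -- one starting point at a time.
    · filter_upwards [ae_crossesLevels hW hm hc σ hC x, hW.eval_zero_ae_eq_zero] with ω hω h0
      refine tendsto_integral_filter_of_dominated_convergence
        (fun t ↦ Real.exp (-α * t) * K) (.of_forall fun x' ↦ ?_)
        (.of_forall fun x' ↦ .of_forall fun t ↦ hbound _) hexp (htendsto _ (hc ω) h0 x hω)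
      exact (hG.comp measurable_prodMk_left).aestronglyMeasurable

theorem IsReflectedBrownianMotion.stoppedResolventPreserves (hσ : 0 < σ)
    (hX : IsReflectedBrownianMotion σ X P) {C : Set unitInterval} (hC : C.Countable)
    (hCc : IsClosed C) : StoppedResolventPreserves X P C := fun α hα f ↦
  hX.integrable_and_continuous_integral hC
    (measurable_stoppedIntegrand hCc α f.continuous.measurable) hα
    (norm_stoppedIntegrand_le _ C α f)
    (fun _ hb h0 _ hcross ↦ .of_forall fun t ↦ tendsto_stoppedIntegrand hσ hb h0 hCc hcross α f t)
    fun _ hω t ↦ stoppedIntegrand_congr (fun s ↦ (coordinate_toPath hω s).symm) α f t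

theorem IsReflectedBrownianMotion.killedResolventPreserves (hσ : 0 < σ)
    (hX : IsReflectedBrownianMotion σ X P) {C : Set unitInterval} (hC : C.Countable)
    (hCc : IsClosed C) : KilledResolventPreserves X P C := fun α hα f ↦
  hX.integrable_and_continuous_integral hC
    (measurable_killedIntegrand hCc α f.continuous.measurable) hα
    (norm_killedIntegrand_le _ C α f)
    (fun _ hb h0 _ hcross ↦ (ae_ne_hitTime _).mono fun _ ht ↦
      tendsto_killedIntegrand hσ hb h0 hCc hcross α f ht)
    fun _ hω t ↦ killedIntegrand_congr (fun s ↦ (coordinate_toPath hω s).symm) α f t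

end ReflectedBM

theorem BarlowEvans.finite_of_mem_finiteUnions {F : Type*} {B : ℕ → Set F}
    (hB : ∀ n, (B n).Finite) {C : Set F} (hC : C ∈ finiteUnions B) : C.Finite := by
  obtain ⟨s, rfl⟩ := hC
  exact s.finite_toSet.biUnion fun n _ ↦ hB n

end

theorem mainTheorem12 {Ω : Type*} [MeasurableSpace Ω] (σ : ℝ) (hσ : 0 < σ)
    (X : ℝ≥0 → Ω → unitInterval) (P : unitInterval → Measure Ω)
    (hX : ReflectedBM.IsReflectedBrownianMotion σ X P)
    (B : ℕ → Set unitInterval) (hB : ∀ n, (B n).Finite) :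
    BarlowEvans.Assumption X P B ∧
      ∀ C ∈ BarlowEvans.finiteUnions B, BarlowEvans.KilledResolventPreserves X P C := by
  have hfin : ∀ C ∈ BarlowEvans.finiteUnions B, C.Finite := fun C hC ↦
    BarlowEvans.finite_of_mem_finiteUnions hB hC
  exact ⟨fun C hC ↦ hX.stoppedResolventPreserves hσ (hfin C hC).countable (hfin C hC).isClosed,
    fun C hC ↦ hX.killedResolventPreserves hσ (hfin C hC).countable (hfin C hC).isClosed⟩
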